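/- Let $(X,Y)$ be a random pair with $X\in\mathbb{R}^p$ and $Y$ in a metric space $(\mathcal Y,d)$, let $(X',Y')$ be an independent copy of $(X,Y)$, and suppose $E\,d^2(Y,Y')<\infty$. Let $\mathcal{H}_X$ be a real reproducing kernel Hilbert space of functions on $\mathbb{R}^p$ with kernel $\kappa_X$, the map $x\mapsto\kappa_X(\cdot,x)\in\mathcal H_X$ being strongly measurable (up to $P_X$-null sets), where $P_X$ is the law of $X$. Put $\mu_X=E\kappa_X(\cdot,X)$ and, with $(a\otimes b)g=\langle b,g\rangle a$, $$\Sigma_{XX}=E\{\kappa_X(\cdot,X)\otimes\kappa_X(\cdot,X)\}-\mu_X\otimes\mu_X,\qquad \Lambda_{XX'}=-E\{(\kappa_X(\cdot,X)-\mu_X)\otimes(\kappa_X(\cdot,X')-\mu_X)\,d(Y,Y')\}.$$ Call a measurable $f:\mathbb{R}^p\to\mathbb{R}^{d_f}$ (any dimension $d_f$) a sufficient predictor if $Y$ and $X$ are conditionally independent given $f(X)$. The central class $\mathcal{G}_{Y|X}$ is the set of all $g\in\mathcal{H}_X$ such that, for every sufficient predictor $f$, $g(X)$ is almost surely equal to a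 measurable function of $f(X)$. Assume that 1. $E\kappa_X(X,X)<\infty$; 2. $\Lambda_{XX'}=\Sigma_{XX}S$ for a unique bounded linear operator $S:\mathcal{H}_X\to\mathcal{H}_X$ with $S=Q_XSQ_X$, where $Q_X$ is the orthogonal projection onto the closure of the range of $\Sigma_{XX}$; 3. there is a sufficient predictor $f$ such that, with $\mathcal{M}_{Y|X}=\sigma(f)$, $\mathcal{G}_{Y|X}$ is dense in $L_2(P_X|\mathcal{M}_{Y|X})$, the space of $\mathcal{M}_{Y|X}$-measurable functions in $L_2(P_X)$. For $y$ in the range of $\Sigma_{XX}$ let $\Sigma_{XX}^{-1}y$ be the unique $z$ in the closure of the range of $\Sigma_{XX}$ with $\Sigma_{XX}z=y$; by 2, $\Sigma_{XX}^{-1}\Lambda_{XX'}$ is defined on all of $\mathcal{H}_X$. Then $$\overline{\mathrm{ran}}\{\Sigma_{XX}^{-1}\Lambda_{XX'}\}\subseteq\mathcal{G}_{Y|X},$$ where the closure is taken in $\mathcal{H}_X$. -/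

import Mathlib

open MeasureTheory ProbabilityTheory Filter
open scoped ENNReal

noncomputable section

namespace WIRE

/-- `X` and `Y` are conditionally independent given the sub-σ-algebra `m`:
`P(X ∈ A, Y ∈ B | m) = P(X ∈ A | m) * P(Y ∈ B | m)` almost surely, for all measurable `A`, `B`.
(Stated through conditional expectations, so that no standard Borel assumption is needed.) -/
def CondIndepGiven {Ω α β : Type*} [MeasurableSpace Ω] [MeasurableSpace α] [MeasurableSpace β]
    (P : Measure Ω) (m : MeasurableSpace Ω) (X : Ω → α) (Y : Ω → β) : Prop :=
  ∀ (A : Set α) (B : Set β), MeasurableSet A → MeasurableSet B →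
    P[(X ⁻¹' A ∩ Y ⁻¹' B).indicator (fun _ => (1 : ℝ)) | m]
      =ᵐ[P] P[(X ⁻¹' A).indicator (fun _ => (1 : ℝ)) | m]
        * P[(Y ⁻¹' B).indicator (fun _ => (1 : ℝ)) | m]

/-- `f : ℝᵖ → ℝᵈ` is a sufficient predictor: `f` is measurable and `Y ⫫ X | f(X)`. -/
def IsSufficientPredictor {Ω 𝒴 : Type*} [MeasurableSpace Ω] [MeasurableSpace 𝒴] {p d : ℕ}
    (P : Measure Ω) (X : Ω → EuclideanSpace ℝ (Fin p)) (Y : Ω → 𝒴)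
    (f : EuclideanSpace ℝ (Fin p) → EuclideanSpace ℝ (Fin d)) : Prop :=
  Measurable f ∧
    CondIndepGiven P (MeasurableSpace.comap (fun ω => f (X ω)) inferInstance) X Y

section RKHS

variable {p : ℕ} (H : Type*) [NormedAddCommGroup H] [InnerProductSpace ℝ H]
  [RKHS ℝ H (EuclideanSpace ℝ (Fin p)) ℝ]

/-- The functions `g ∈ H` for which `g(X)` is almost surely a measurable function of `f(X)`. -/
def functionsOf {Ω : Type*} [MeasurableSpace Ω] {d : ℕ}
    (P : Measure Ω) (X : Ω → EuclideanSpace ℝ (Fin p))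
    (f : EuclideanSpace ℝ (Fin p) → EuclideanSpace ℝ (Fin d)) : Submodule ℝ H where
  carrier := {g | ∃ φ : EuclideanSpace ℝ (Fin d) → ℝ, Measurable φ ∧
    (fun ω => g (X ω)) =ᵐ[P] fun ω => φ (f (X ω))}
  zero_mem' := ⟨fun _ => 0, measurable_const, by simp⟩
  add_mem' := by
    rintro a b ⟨φ, hφ, ha⟩ ⟨ψ, hψ, hb⟩
    refine ⟨fun x => φ x + ψ x, hφ.add hψ, ?_⟩
    filter_upwards [ha, hb] with ω h1 h2
    simp [h1, h2]
  smul_mem' := by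
    rintro c a ⟨φ, hφ, ha⟩
    refine ⟨fun x => c * φ x, hφ.const_mul c, ?_⟩
    filter_upwards [ha] with ω h1
    simp [h1]

/-- The central class `𝒢_{Y|X}`: the smallest of the spaces of functions of a sufficient predictor,
that is, the functions in `H` that are, almost surely, functions of `f(X)` for every sufficient
predictor `f`. -/
def centralClass {Ω 𝒴 : Type*} [MeasurableSpace Ω] [MeasurableSpace 𝒴]
    (P : Measure Ω) (X : Ω → EuclideanSpace ℝ (Fin p)) (Y : Ω → 𝒴) : Submodule ℝ H :=
  ⨅ (d : ℕ) (f : EuclideanSpace ℝ (Fin p) → EuclideanSpace ℝ (Fin d))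
    (_ : IsSufficientPredictor P X Y f), functionsOf H P X f

/-- `𝒢_{Y|X}` is dense in `L₂(P_X | σ(f))`, the `σ(f)`-measurable functions in `L₂(P_X)`. -/
def CentralClassDense {Ω 𝒴 : Type*} [MeasurableSpace Ω] [MeasurableSpace 𝒴] {d : ℕ}
    (P : Measure Ω) (X : Ω → EuclideanSpace ℝ (Fin p)) (Y : Ω → 𝒴)
    (f : EuclideanSpace ℝ (Fin p) → EuclideanSpace ℝ (Fin d)) : Prop :=
  ∀ v : EuclideanSpace ℝ (Fin p) → ℝ,
    Measurable[MeasurableSpace.comap f inferInstance] v → MemLp v 2 (P.map X) →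
    ∀ ε : ℝ≥0∞, 0 < ε → ∃ g ∈ centralClass H P X Y,
      eLpNorm (fun x => g x - v x) 2 (P.map X) < ε

variable [CompleteSpace H]

/-- The reproducing kernel `κ(x, x')` of `H`. -/
def kappa (x x' : EuclideanSpace ℝ (Fin p)) : ℝ := RKHS.kernel H x x' 1

/-- The kernel section `κ(·, x)`, as an element of `H`. -/
def feature (x : EuclideanSpace ℝ (Fin p)) : H := RKHS.kerFun H x (1 : ℝ)

variable {Ω : Type*} [MeasurableSpace Ω] (P : Measure Ω) (X : Ω → EuclideanSpace ℝ (Fin p))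

/-- The mean element `μ_X = E κ(·, X)`. -/
def meanElement : H := ∫ ω, feature H (X ω) ∂P

/-- The covariance operator `Σ_XX = E[κ(·,X) ⊗ κ(·,X)] - E κ(·,X) ⊗ E κ(·,X)`, with
`(a ⊗ b) g = ⟨b, g⟩ a`. -/
def covOp : H →L[ℝ] H :=
  (∫ ω, InnerProductSpace.rankOne ℝ (feature H (X ω)) (feature H (X ω)) ∂P)
    - InnerProductSpace.rankOne ℝ (meanElement H P X) (meanElement H P X)

/-- The weighted inverse regression ensemble operator
`Λ_XX' = - E[(κ(·,X) - μ_X) ⊗ (κ(·,X') - μ_X) d(Y,Y')]`, where `(X', Y')` is an independent copy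
of `(X, Y)`, realized on the product space. -/
def wireOp {𝒴 : Type*} [MetricSpace 𝒴] (Y : Ω → 𝒴) : H →L[ℝ] H :=
  -∫ z : Ω × Ω, dist (Y z.1) (Y z.2) •
      InnerProductSpace.rankOne ℝ (feature H (X z.1) - meanElement H P X)
        (feature H (X z.2) - meanElement H P X) ∂(P.prod P)

/-- `Λ_XX'` has a representation `Λ_XX' = Σ_XX S` with a unique bounded linear `S` satisfying
`S = Q S Q`, where `Q` is the orthogonal projection onto the closure of the range of `Σ_XX`. -/
def HasCovRepresentation {𝒴 : Type*} [MetricSpace 𝒴] (Y : Ω → 𝒴) : Prop :=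
  let Q : H →L[ℝ] H := (covOp H P X).range.topologicalClosure.starProjection
  ∃! S : H →L[ℝ] H, wireOp H P X Y = covOp H P X ∘L S ∧ S = Q ∘L S ∘L Q

end RKHS

section Inverse

variable {H : Type*} [NormedAddCommGroup H] [InnerProductSpace ℝ H]

/-- The (generally unbounded) inverse `T⁻¹` of a self-adjoint operator `T`: for `y` in the range
of `T`, the unique `z` in the closure of the range of `T` with `T z = y`, if there is one.
Elsewhere the value is unspecified. -/
def opInv (T : H →L[ℝ] H) (y : H) : H :=
  Function.invFunOn T (T.range.topologicalClosure : Set H) y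

theorem opInv_apply [CompleteSpace H] (T : H →L[ℝ] H) (hT : IsSelfAdjoint T) (z : H)
    (hz : z ∈ T.range.topologicalClosure) : opInv T (T z) = z := by
  have hmem : opInv T (T z) ∈ T.range.topologicalClosure :=
    Function.invFunOn_mem (s := (T.range.topologicalClosure : Set H)) ⟨z, hz, rfl⟩
  have heq : T (opInv T (T z)) = T z :=
    Function.invFunOn_eq (s := (T.range.topologicalClosure : Set H)) ⟨z, hz, rfl⟩
  have hsub : opInv T (T z) - z ∈ T.range.topologicalClosure := Submodule.sub_mem _ hmem hz
  have hker : T (opInv T (T z) - z) = 0 := by rw [map_sub, heq, sub_self]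
  have horth : opInv T (T z) - z ∈ T.rangeᗮ := by
    rw [Submodule.mem_orthogonal]
    rintro _ ⟨w, rfl⟩
    have h := ContinuousLinearMap.adjoint_inner_right T w (opInv T (T z) - z)
    rw [ContinuousLinearMap.isSelfAdjoint_iff'.mp hT, hker, inner_zero_right] at h
    exact h.symm
  rw [← Submodule.orthogonal_closure] at horth
  have h0 := (Submodule.mem_orthogonal _ _).mp horth _ hsub
  exact sub_eq_zero.mp (inner_self_eq_zero.mp h0)

end Inverse

end WIRE

end

/-! Fix `g` and put a(y) = -E[(g(X') - E g(X)) d(y,Y')]. Pairing with `k` turns Σ into the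
covariance of k(X) and u(X) (`inner_covOp`), and Λ into the covariance of k(X) and a(Y)
(`inner_wireOp`). So u = Σ⁻¹Λg = Sg has the same covariances with all of `H` as a(Y), and by
sufficiency the same as w = E[a(Y) | f(X)] (`CondIndepGiven.integral_mul_eq`). Density puts w in the
L² closure of `H`, so the centred u(X) - w is orthogonal to `H`, to w and to constants, hence to
itself: u(X) is w plus a constant (`exists_ae_eq_add_const_of_covariance_eq`).

Density also identifies the central class with the functions of this one f(X)
(`centralClass_eq_functionsOf`), a closed subspace of `H` (`isClosed_functionsOf`), so the closure
adds nothing. -/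

namespace WIRE

/-! ### Square-integrable functions, conditional expectation and conditional independence. -/

section General

variable {Ω α β : Type*} {m : MeasurableSpace Ω} [mΩ : MeasurableSpace Ω] {P : Measure Ω}

theorem enorm_integral_mul_le {a b : Ω → ℝ} (ha : AEStronglyMeasurable a P)
    (hb : AEStronglyMeasurable b P) :
    ‖∫ ω, a ω * b ω ∂P‖ₑ ≤ eLpNorm a 2 P * eLpNorm b 2 P := by
  refine (enorm_integral_le_lintegral_enorm _).trans ?_
  rw [← eLpNorm_one_eq_lintegral_enorm]
  have h := eLpNorm_smul_le_mul_eLpNorm (p := 2) (q := 2) (r := 1) hb ha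
  exact h

/-- Hilbert–Schmidt bound: Cauchy–Schwarz on each slice, then Tonelli. It makes a(Y) square
integrable. -/
theorem memLp_two_integral_mul [mα : MeasurableSpace α] {μ : Measure α} [SFinite μ] [SFinite P]
    {F : Ω × α → ℝ} {h : α → ℝ} (hF : MemLp F 2 (P.prod μ)) (hh : MemLp h 2 μ) :
    MemLp (fun ω => ∫ x, h x * F (ω, x) ∂μ) 2 P := by
  refine ⟨(hh.1.comp_snd.mul hF.1).integral_prod_right', ?_⟩
  rw [eLpNorm_lt_top_iff_lintegral_rpow_enorm_lt_top two_ne_zero ENNReal.ofNat_ne_top]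
  have hfin := (eLpNorm_lt_top_iff_lintegral_rpow_enorm_lt_top two_ne_zero
    ENNReal.ofNat_ne_top).1 hF.2
  rw [lintegral_prod _ (by exact hF.1.enorm.pow_const _)] at hfin
  have hC : eLpNorm h 2 μ ^ (2 : ℝ) < ∞ := ENNReal.rpow_lt_top_of_nonneg (by norm_num) hh.2.ne
  refine lt_of_le_of_lt ?_ (ENNReal.mul_lt_top hC hfin)
  rw [← lintegral_const_mul' _ _ hC.ne]
  refine lintegral_mono_ae ?_
  filter_upwards [hF.1.prodMk_left] with ω hω
  have h1 := enorm_integral_mul_le hh.1 hω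
  have h2 := ENNReal.rpow_le_rpow h1 (by norm_num : (0 : ℝ) ≤ 2)
  refine h2.trans (le_of_eq ?_)
  rw [ENNReal.mul_rpow_of_nonneg _ _ (by norm_num : (0 : ℝ) ≤ 2)]
  congr 1
  rw [eLpNorm_eq_lintegral_rpow_enorm_toReal two_ne_zero ENNReal.ofNat_ne_top]
  simp only [ENNReal.toReal_ofNat]
  rw [← ENNReal.rpow_mul]
  norm_num

/-- An `L²` limit of functions that are a.e. `m`-measurable is a.e. `m`-measurable. -/
theorem aestronglyMeasurable_of_forall_eLpNorm_sub_lt [IsFiniteMeasure P]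
    (hm : m ≤ mΩ) {v : Ω → ℝ} (hv : MemLp v 2 P)
    (h : ∀ ε : ℝ≥0∞, 0 < ε → ∃ g : Ω → ℝ, MemLp g 2 P ∧ AEStronglyMeasurable[m] g P ∧
      eLpNorm (g - v) 2 P < ε) :
    AEStronglyMeasurable[m] v P := by
  suffices hz : eLpNorm (v - P[v | m]) 2 P = 0 by
    rw [eLpNorm_eq_zero_iff (hv.1.sub integrable_condExp.1) two_ne_zero] at hz
    refine ⟨P[v | m], stronglyMeasurable_condExp, ?_⟩
    filter_upwards [hz] with ω hω
    exact sub_eq_zero.1 hω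
  by_contra hne
  have hpos := pos_iff_ne_zero.2 hne
  -- As `g` is fixed by conditioning, v - E[v|m] = (v - g) + E[g - v|m] has norm at most 2‖g - v‖;
  -- hence the half.
  obtain ⟨g, hg, hgm, hlt⟩ := h _ (ENNReal.half_pos hne)
  have h1 : v - P[v | m] =ᵐ[P] (v - g) + P[g - v | m] := by
    have hgi := hg.integrable one_le_two
    have hvi := hv.integrable one_le_two
    filter_upwards [condExp_sub hgi hvi m, condExp_of_aestronglyMeasurable' hm hgm hgi]
      with ω h2 h3
    simp only [Pi.sub_apply, Pi.add_apply] at h2 ⊢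
    rw [h2, h3]; ring
  have h4 : eLpNorm (v - P[v | m]) 2 P ≤ eLpNorm (g - v) 2 P + eLpNorm (g - v) 2 P := by
    rw [eLpNorm_congr_ae h1]
    refine (eLpNorm_add_le (hv.1.sub hg.1) integrable_condExp.1 one_le_two).trans ?_
    rw [eLpNorm_sub_comm]
    gcongr
    exact eLpNorm_condExp_le_eLpNorm _ one_le_two
  have h5 := h4.trans_lt (ENNReal.add_lt_add hlt hlt)
  rw [ENNReal.add_halves] at h5
  exact h5.false

/-- A square integrable `u` in a family `k`, with the same covariances with the family as some `w` in
the `L²` closure of the family, differs from `w` by a constant. -/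
theorem exists_ae_eq_add_const_of_covariance_eq [IsProbabilityMeasure P] {ι : Type*}
    {k : ι → Ω → ℝ} (hk : ∀ i, MemLp (k i) 2 P) {w : Ω → ℝ} (hw : MemLp w 2 P)
    (happrox : ∀ ε : ℝ≥0∞, 0 < ε → ∃ i, eLpNorm (k i - w) 2 P < ε) (j : ι)
    (hcov : ∀ i, ∫ ω, k i ω * k j ω ∂P - (∫ ω, k i ω ∂P) * ∫ ω, k j ω ∂P
      = ∫ ω, k i ω * w ω ∂P - (∫ ω, k i ω ∂P) * ∫ ω, w ω ∂P) :
    ∃ c : ℝ, k j =ᵐ[P] fun ω => w ω + c := by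
  have hi {b : Ω → ℝ} (hb : MemLp b 2 P) : Integrable b P := hb.integrable one_le_two
  have hsub {a b : Ω → ℝ} (ha : Integrable a P) (hb : Integrable b P) :
      Integrable (fun ω => a ω - b ω) P := ha.sub hb
  have hmul {a b : Ω → ℝ} (ha : MemLp a 2 P) (hb : MemLp b 2 P) :
      Integrable (fun ω => a ω * b ω) P := ha.integrable_mul hb
  set c := ∫ ω, (k j ω - w ω) ∂P with hc
  set r : Ω → ℝ := fun ω => k j ω - w ω - c with hr
  have hrL : MemLp r 2 P := ((hk j).sub hw).sub (memLp_const c)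
  have hr0 : ∫ ω, r ω ∂P = 0 := by
    simp only [hr]
    rw [integral_sub (hsub (hi (hk j)) (hi hw)) (integrable_const c)]
    simp [hc]
  have hrk : ∀ i, ∫ ω, k i ω * r ω ∂P = 0 := by
    intro i
    have h3 : ∫ ω, k i ω * r ω ∂P = ∫ ω, k i ω * k j ω ∂P - ∫ ω, k i ω * w ω ∂P
        - (∫ ω, k i ω ∂P) * c := by
      simp only [hr, mul_sub]
      rw [integral_sub (hsub (hmul (hk i) (hk j)) (hmul (hk i) hw)) ((hi (hk i)).mul_const _),
        integral_sub (hmul (hk i) (hk j)) (hmul (hk i) hw), integral_mul_const]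
    rw [h3, hc, integral_sub (hi (hk j)) (hi hw)]
    linear_combination hcov i
  have hrw : ∫ ω, w ω * r ω ∂P = 0 := by
    by_contra hne
    have hpos : (0 : ℝ≥0∞) < ‖∫ ω, w ω * r ω ∂P‖ₑ := by simpa using hne
    -- The tolerance |E[wr]| / ‖r‖₂ is ∞ when ‖r‖₂ = 0, so no case split is needed.
    obtain ⟨i, hlt⟩ := happrox _ (ENNReal.div_pos hpos.ne' hrL.2.ne)
    have h1 : ∫ ω, (k i ω - w ω) * r ω ∂P = -∫ ω, w ω * r ω ∂P := by
      simp only [sub_mul]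
      rw [integral_sub (hmul (hk i) hrL) (hmul hw hrL), hrk i, zero_sub]
    have h2 := (enorm_integral_mul_le ((hk i).sub hw).1 hrL.1).trans_lt
      (ENNReal.mul_lt_of_lt_div hlt)
    simp only [Pi.sub_apply] at h2
    rw [h1, enorm_neg] at h2
    exact h2.false
  have hrr : ∫ ω, r ω ^ 2 ∂P = 0 := by
    have h1 : ∀ ω, r ω ^ 2 = k j ω * r ω - w ω * r ω - c * r ω := fun ω => by
      simp only [hr]; ring
    simp only [h1]
    rw [integral_sub (hsub (hmul (hk j) hrL) (hmul hw hrL)) ((hi hrL).const_mul c),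
      integral_sub (hmul (hk j) hrL) (hmul hw hrL), integral_const_mul, hrk j, hrw, hr0]
    simp
  rw [integral_eq_zero_iff_of_nonneg (fun ω => sq_nonneg _) hrL.integrable_sq] at hrr
  refine ⟨c, ?_⟩
  filter_upwards [hrr] with ω hω
  have h1 : r ω = 0 := by simpa using hω
  simp only [hr] at h1
  linarith

variable [mα : MeasurableSpace α] [mβ : MeasurableSpace β] [IsFiniteMeasure P]

/-- Tested on {X ∈ A}: E[1_A E[1_B|m]] = E[E[1_A|m] E[1_B|m]], which conditional independence turns
into P(X ∈ A, Y ∈ B). -/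
theorem CondIndepGiven.condExp_indicator_eq {X : Ω → α} {Y : Ω → β}
    (hXY : CondIndepGiven P m X Y) (hX : Measurable X) (hY : Measurable Y)
    (hm : m ≤ mα.comap X) {B : Set β} (hB : MeasurableSet B) :
    P[(Y ⁻¹' B).indicator (fun _ => (1 : ℝ)) | mα.comap X]
      =ᵐ[P] P[(Y ⁻¹' B).indicator (fun _ => (1 : ℝ)) | m] := by
  have hXm : mα.comap X ≤ mΩ := hX.comap_le
  have hint : ∀ s : Set Ω, MeasurableSet s → Integrable (s.indicator fun _ => (1 : ℝ)) P :=
    fun s hs => (integrable_const 1).indicator hs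
  have hYB := hY hB
  refine (ae_eq_condExp_of_forall_setIntegral_eq hXm (hint _ hYB)
    (fun _ _ _ => integrable_condExp.integrableOn) ?_
    (stronglyMeasurable_condExp.mono hm).aestronglyMeasurable).symm
  rintro _ ⟨A, hA, rfl⟩ -
  have hXA := hX hA
  set b := (Y ⁻¹' B).indicator fun _ => (1 : ℝ)
  set a := (X ⁻¹' A).indicator fun _ => (1 : ℝ) with ha
  have hab : ∀ c : Ω → ℝ, a * c = (X ⁻¹' A).indicator c := by
    intro c; ext ω; by_cases hω : ω ∈ X ⁻¹' A <;> simp [ha, hω]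
  have h1 : (X ⁻¹' A ∩ Y ⁻¹' B).indicator (fun _ => (1 : ℝ)) = (X ⁻¹' A).indicator b := by
    ext ω
    by_cases h1 : ω ∈ X ⁻¹' A <;> by_cases h2 : ω ∈ Y ⁻¹' B <;> simp_all [b]
  have h2 := hXY A B hA hB
  have hac : Integrable (a * P[b | m]) P := by
    rw [hab]; exact integrable_condExp.indicator hXA
  have h3 : P[a * P[b | m] | m] =ᵐ[P] P[a | m] * P[b | m] :=
    condExp_mul_of_stronglyMeasurable_right stronglyMeasurable_condExp hac (hint _ hXA)
  rw [← integral_indicator hXA, ← integral_indicator hXA, ← h1, ← hab,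
    ← integral_condExp (hm.trans hXm), integral_congr_ae h3, ← integral_congr_ae h2,
    integral_condExp (hm.trans hXm)]

theorem CondIndepGiven.condExp_comp_eq {X : Ω → α} {Y : Ω → β}
    (hXY : CondIndepGiven P m X Y) (hX : Measurable X) (hY : Measurable Y)
    (hm : m ≤ mα.comap X) {a : β → ℝ} (ha : Integrable a (P.map Y)) :
    P[fun ω => a (Y ω) | mα.comap X] =ᵐ[P] P[fun ω => a (Y ω) | m] := by
  have hXm : mα.comap X ≤ mΩ := hX.comap_le
  have hmm := hm.trans hXm
  have hmp : MeasurePreserving Y P (P.map Y) := hY.measurePreserving P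
  refine Integrable.induction (fun a : β → ℝ =>
    P[fun ω => a (Y ω) | mα.comap X] =ᵐ[P] P[fun ω => a (Y ω) | m]) ?_ ?_ ?_ ?_ ha
  · intro c s hs _
    have h0 : (fun ω => s.indicator (fun _ => c) (Y ω))
        = c • (Y ⁻¹' s).indicator (fun _ => (1 : ℝ)) := by
      ext ω; by_cases hω : Y ω ∈ s <;> simp [hω]
    rw [h0]
    filter_upwards [condExp_smul c ((Y ⁻¹' s).indicator fun _ => (1 : ℝ)) (mα.comap X),
      condExp_smul c ((Y ⁻¹' s).indicator fun _ => (1 : ℝ)) m,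
      hXY.condExp_indicator_eq hX hY hm hs] with ω h1 h2 h3
    rw [h1, h2, Pi.smul_apply, Pi.smul_apply, h3]
  · intro f g _ hf hg hf' hg'
    have hfi := hmp.integrable_comp_of_integrable hf
    have hgi := hmp.integrable_comp_of_integrable hg
    filter_upwards [condExp_add hfi hgi (mα.comap X), condExp_add hfi hgi m, hf', hg']
      with ω h1 h2 h3 h4
    exact h1.trans ((congr_arg₂ (· + ·) h3 h4).trans h2.symm)
  -- Both sides are continuous in `a` for the L¹ norm, so the equality set is closed.
  · have hL : Continuous fun f : β →₁[P.map Y] ℝ => Lp.compMeasurePreserving Y hmp f :=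
      (Lp.isometry_compMeasurePreserving hmp).continuous
    convert isClosed_eq ((condExpL1CLM ℝ hXm P).continuous.comp hL)
      ((condExpL1CLM ℝ hmm P).continuous.comp hL) using 1
    ext f
    have hi : Integrable (fun ω => f (Y ω)) P :=
      hmp.integrable_comp_of_integrable (L1.integrable_coeFn f)
    have he : hi.toL1 _ = Lp.compMeasurePreserving Y hmp f := by
      apply Lp.ext
      filter_upwards [hi.coeFn_toL1, Lp.coeFn_compMeasurePreserving f hmp] with ω h1 h2
      rw [h1, h2]; rfl
    have h1 := condExp_ae_eq_condExpL1CLM hXm hi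
    have h2 := condExp_ae_eq_condExpL1CLM hmm hi
    rw [he] at h1 h2
    simp only [Set.mem_ofPred_eq, Function.comp]
    rw [Lp.ext_iff]
    exact ⟨fun h => h1.symm.trans (h.trans h2), fun h => h1.trans (h.trans h2.symm)⟩
  · intro f g hfg hf hf'
    have h1 := hmp.quasiMeasurePreserving.ae_eq_comp hfg
    exact (condExp_congr_ae h1.symm).trans (hf'.trans (condExp_congr_ae h1))

theorem CondIndepGiven.integral_mul_eq {X : Ω → α} {Y : Ω → β}
    (hXY : CondIndepGiven P m X Y) (hX : Measurable X) (hY : Measurable Y)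
    (hm : m ≤ mα.comap X) {a : β → ℝ} (ham : AEStronglyMeasurable a (P.map Y))
    (ha : MemLp (fun ω => a (Y ω)) 2 P) {k : α → ℝ} (hkm : AEStronglyMeasurable k (P.map X))
    (hk : MemLp (fun ω => k (X ω)) 2 P) :
    ∫ ω, k (X ω) * a (Y ω) ∂P = ∫ ω, k (X ω) * (P[fun ω => a (Y ω) | m]) ω ∂P := by
  have hXm : mα.comap X ≤ mΩ := hX.comap_le
  have hai : Integrable a (P.map Y) :=
    (integrable_map_measure ham hY.aemeasurable).2 (ha.integrable one_le_two)
  -- `k` is measurable only up to null sets, so σ(X)-measurability of k(X) holds only almost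
  -- everywhere.
  have hkX : AEStronglyMeasurable[mα.comap X] (fun ω => k (X ω)) P := by
    refine ⟨fun ω => hkm.mk k (X ω), ?_, ae_of_ae_map hX.aemeasurable hkm.ae_eq_mk⟩
    exact hkm.stronglyMeasurable_mk.comp_measurable (comap_measurable X)
  rw [← integral_condExp hXm]
  refine integral_congr_ae ?_
  filter_upwards [condExp_mul_of_aestronglyMeasurable_left hkX (hk.integrable_mul ha)
    (ha.integrable one_le_two), hXY.condExp_comp_eq hX hY hm hai] with ω h1 h2
  rw [← h2]
  exact h1

end General
-- Bochner integrals of rank-one operators.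
theorem memLp_norm_mul_norm {Ω E : Type*} [MeasurableSpace Ω] {P : Measure Ω} [SFinite P]
    [NormedAddCommGroup E] {ψ : Ω → E} (hψ : MemLp ψ 2 P) :
    MemLp (fun z : Ω × Ω => ‖ψ z.1‖ * ‖ψ z.2‖) 2 (P.prod P) := by
  have hm : AEStronglyMeasurable (fun z : Ω × Ω => ‖ψ z.1‖ * ‖ψ z.2‖) (P.prod P) :=
    hψ.1.norm.comp_fst.mul hψ.1.norm.comp_snd
  rw [memLp_two_iff_integrable_sq hm]
  simpa only [mul_pow] using
    (hψ.integrable_norm_pow two_ne_zero).mul_prod (hψ.integrable_norm_pow two_ne_zero)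

theorem continuous_rankOne {E : Type*} [NormedAddCommGroup E] [InnerProductSpace ℝ E] :
    Continuous fun z : E × E => InnerProductSpace.rankOne ℝ z.1 z.2 := by
  have h : Continuous fun z : E × E =>
      ContinuousLinearMap.smulRightL ℝ E E (innerSL ℝ z.2) z.1 :=
    ((ContinuousLinearMap.smulRightL ℝ E E).continuous.comp
      ((innerSL ℝ).continuous.comp continuous_snd)).clm_apply continuous_fst
  exact h

theorem integrable_rankOne {Ω E : Type*} [MeasurableSpace Ω] {P : Measure Ω}
    [NormedAddCommGroup E] [InnerProductSpace ℝ E] {ψ χ : Ω → E} {c : Ω → ℝ} (hψ : AEStronglyMeasurable ψ P)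
    (hχ : AEStronglyMeasurable χ P) (hc : AEStronglyMeasurable c P)
    (h : Integrable (fun ω => c ω * (‖ψ ω‖ * ‖χ ω‖)) P) :
    Integrable (fun ω => c ω • InnerProductSpace.rankOne ℝ (ψ ω) (χ ω)) P := by
  have hR : AEStronglyMeasurable (fun ω => InnerProductSpace.rankOne ℝ (ψ ω) (χ ω)) P :=
    Continuous.comp_aestronglyMeasurable (f := fun ω => (ψ ω, χ ω)) continuous_rankOne
      (hψ.prodMk hχ)
  refine h.norm.mono' (hc.smul hR) (ae_of_all _ fun ω => ?_)
  simp [norm_smul]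

/-! ### The operators Σ and Λ as bilinear forms. -/

section Feature

variable {p : ℕ} {H : Type*} [NormedAddCommGroup H] [InnerProductSpace ℝ H] [CompleteSpace H]
  [RKHS ℝ H (EuclideanSpace ℝ (Fin p)) ℝ]

theorem inner_feature (x : EuclideanSpace ℝ (Fin p)) (g : H) : inner ℝ (feature H x) g = g x := by
  simp [feature]

theorem norm_feature_sq (x : EuclideanSpace ℝ (Fin p)) : ‖feature H x‖ ^ 2 = kappa H x x := by
  rw [← real_inner_self_eq_norm_sq, inner_feature, feature, RKHS.kerFun_apply, kappa]

variable {Ω : Type*} [MeasurableSpace Ω] {P : Measure Ω} {X : Ω → EuclideanSpace ℝ (Fin p)}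

theorem memLp_feature (hX : Measurable X) (hfeature : AEStronglyMeasurable (feature H) (P.map X))
    (hkappa : Integrable (fun ω => kappa H (X ω) (X ω)) P) :
    MemLp (fun ω => feature H (X ω)) 2 P := by
  refine (memLp_two_iff_integrable_sq_norm (hfeature.comp_measurable hX)).2 ?_
  simpa only [Function.comp_apply, norm_feature_sq] using hkappa

theorem aestronglyMeasurable_apply (hfeature : AEStronglyMeasurable (feature H) (P.map X))
    (g : H) : AEStronglyMeasurable (fun x => g x) (P.map X) := by
  simpa only [inner_feature] using hfeature.inner (𝕜 := ℝ) (aestronglyMeasurable_const (b := g))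

theorem memLp_apply (hφ : MemLp (fun ω => feature H (X ω)) 2 P) (g : H) :
    MemLp (fun ω => g (X ω)) 2 P := by
  simpa only [inner_feature] using hφ.inner_const (𝕜 := ℝ) g

theorem inner_integral_rankOne {T : Ω → H →L[ℝ] H} (hT : Integrable T P) (k g : H) :
    inner ℝ k ((∫ ω, T ω ∂P) g) = ∫ ω, inner ℝ k (T ω g) ∂P := by
  rw [ContinuousLinearMap.integral_apply hT, ← integral_inner (hT.apply_continuousLinearMap g)]

variable [IsProbabilityMeasure P]

theorem inner_meanElement (hφ : MemLp (fun ω => feature H (X ω)) 2 P) (g : H) :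
    inner ℝ (meanElement H P X) g = ∫ ω, g (X ω) ∂P := by
  rw [real_inner_comm, meanElement, ← integral_inner (hφ.integrable one_le_two)]
  simp only [real_inner_comm _ g, inner_feature]

theorem inner_centered (hφ : MemLp (fun ω => feature H (X ω)) 2 P) (g : H) (ω : Ω) :
    inner ℝ (feature H (X ω) - meanElement H P X) g = g (X ω) - ∫ ω, g (X ω) ∂P := by
  rw [inner_sub_left, inner_feature, inner_meanElement hφ]

theorem inner_covOp (hφ : MemLp (fun ω => feature H (X ω)) 2 P) (k g : H) :
    inner ℝ k (covOp H P X g)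
      = ∫ ω, k (X ω) * g (X ω) ∂P - (∫ ω, k (X ω) ∂P) * ∫ ω, g (X ω) ∂P := by
  have hT : Integrable (fun ω =>
      InnerProductSpace.rankOne ℝ (feature H (X ω)) (feature H (X ω))) P := by
    simpa only [one_smul] using integrable_rankOne (c := fun _ => 1) hφ.1 hφ.1
      aestronglyMeasurable_const (by simpa only [one_mul] using! hφ.norm.integrable_mul hφ.norm)
  rw [covOp, sub_apply, inner_sub_right, inner_integral_rankOne hT]
  simp only [InnerProductSpace.rankOne_apply, real_inner_smul_left, inner_feature,
    inner_meanElement hφ, real_inner_comm _ k]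
  simp only [mul_comm]

theorem isSelfAdjoint_covOp (hφ : MemLp (fun ω => feature H (X ω)) 2 P) :
    IsSelfAdjoint (covOp H P X) := by
  rw [ContinuousLinearMap.isSelfAdjoint_iff_isSymmetric]
  intro k g
  rw [ContinuousLinearMap.coe_coe, real_inner_comm, inner_covOp hφ, inner_covOp hφ]
  simp only [mul_comm]

variable {𝒴 : Type*} [MetricSpace 𝒴] {Y : Ω → 𝒴}

/-- The inner integral depends on `ω` only through `Y ω`, so the form is a covariance of k(X) with a
function of Y. -/
theorem inner_wireOp (hφ : MemLp (fun ω => feature H (X ω)) 2 P)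
    (hdist : MemLp (fun z : Ω × Ω => dist (Y z.1) (Y z.2)) 2 (P.prod P)) (k g : H) :
    inner ℝ k (wireOp H P X Y g)
      = -∫ ω, (k (X ω) - ∫ ω, k (X ω) ∂P)
          * ∫ ω', (g (X ω') - ∫ ω, g (X ω) ∂P) * dist (Y ω) (Y ω') ∂P ∂P := by
  have hψ : MemLp (fun ω => feature H (X ω) - meanElement H P X) 2 P := hφ.sub (memLp_const _)
  have hT := integrable_rankOne hψ.1.comp_fst hψ.1.comp_snd hdist.1
    (hdist.integrable_mul (memLp_norm_mul_norm hψ))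
  have hT' := (hT.apply_continuousLinearMap g).const_inner (𝕜 := ℝ) k
  rw [wireOp, neg_apply, inner_neg_right, inner_integral_rankOne hT,
    integral_prod _ hT']
  congr 1
  refine integral_congr_ae (ae_of_all _ fun ω => ?_)
  simp only [smul_apply, InnerProductSpace.rankOne_apply, real_inner_smul_left,
    real_inner_comm _ k, inner_centered hφ]
  rw [← integral_const_mul]
  congr 1
  ext ω'
  ring

end Feature

/-- Lipschitz with constant E|h| by the triangle inequality. This makes a(y) Borel without
separability of `𝒴`. -/
theorem continuous_integral_mul_dist {Ω 𝒴 : Type*} [MeasurableSpace Ω] {P : Measure Ω}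
    [MetricSpace 𝒴] [MeasurableSpace 𝒴] [BorelSpace 𝒴] {Y : Ω → 𝒴} (hY : Measurable Y)
    {h : Ω → ℝ} (hh : Integrable h P) {y₀ : 𝒴}
    (h₀ : Integrable (fun ω => h ω * dist y₀ (Y ω)) P) :
    Continuous fun y => ∫ ω, h ω * dist y (Y ω) ∂P := by
  have hm : ∀ y, AEStronglyMeasurable (fun ω => h ω * dist y (Y ω)) P := fun y =>
    hh.1.mul ((continuous_const.dist continuous_id).measurable.comp hY).aestronglyMeasurable
  have hi : ∀ y, Integrable (fun ω => h ω * dist y (Y ω)) P := by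
    intro y
    refine ((hh.norm.const_mul (dist y y₀)).add h₀.norm).mono' (hm y) (ae_of_all _ fun ω => ?_)
    simp only [Pi.add_apply, norm_mul, Real.norm_eq_abs, abs_of_nonneg dist_nonneg]
    have := mul_le_mul_of_nonneg_left (dist_triangle y y₀ (Y ω)) (abs_nonneg (h ω))
    linarith
  refine LipschitzWith.continuous (K := (∫ ω, ‖h ω‖ ∂P).toNNReal)
    (LipschitzWith.of_dist_le_mul fun y y' => ?_)
  rw [Real.coe_toNNReal _ (integral_nonneg fun _ => norm_nonneg _), dist_eq_norm,
    ← integral_sub (hi y) (hi y'), ← integral_mul_const]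
  refine norm_integral_le_of_norm_le (hh.norm.mul_const _) (ae_of_all _ fun ω => ?_)
  rw [← mul_sub, norm_mul]
  gcongr
  exact abs_dist_sub_le y y' (Y ω)

/-! ### The central class and functions of a sufficient predictor. -/

section CentralClass

variable {p d : ℕ} {H : Type*} [NormedAddCommGroup H] [InnerProductSpace ℝ H]
  [RKHS ℝ H (EuclideanSpace ℝ (Fin p)) ℝ]
  {Ω : Type*} [MeasurableSpace Ω] {P : Measure Ω} {X : Ω → EuclideanSpace ℝ (Fin p)}
  {f : EuclideanSpace ℝ (Fin p) → EuclideanSpace ℝ (Fin d)}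

/-- Doob–Dynkin factorization. -/
theorem mem_functionsOf_iff {g : H} : g ∈ functionsOf H P X f ↔
    AEStronglyMeasurable[MeasurableSpace.comap (fun ω => f (X ω)) inferInstance]
      (fun ω => g (X ω)) P := by
  constructor
  · rintro ⟨φ, hφ, h⟩
    exact ⟨_, (hφ.comp (comap_measurable _)).stronglyMeasurable, h⟩
  · rintro ⟨u, hu, h⟩
    obtain ⟨φ, hφ, rfl⟩ := hu.exists_eq_measurable_comp
    exact ⟨φ, hφ.measurable, h⟩

variable [CompleteSpace H] {𝒴 : Type*} [MeasurableSpace 𝒴] {Y : Ω → 𝒴}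

/-- If `𝒢_{Y|X}` is dense in `L₂(P_X | σ(f))`, then the square integrable functions of `f(X)` can be
approximated by elements of `𝒢_{Y|X}`. -/
theorem CentralClassDense.exists_eLpNorm_sub_lt (hdense : CentralClassDense H P X Y f)
    (hX : Measurable X) (hf : Measurable f)
    (hfeature : AEStronglyMeasurable (feature H) (P.map X)) {v : Ω → ℝ}
    (hvm : AEStronglyMeasurable[MeasurableSpace.comap (fun ω => f (X ω)) inferInstance] v P)
    (hv : MemLp v 2 P) {ε : ℝ≥0∞} (hε : 0 < ε) :
    ∃ g ∈ centralClass H P X Y, eLpNorm ((fun ω => g (X ω)) - v) 2 P < ε := by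
  obtain ⟨u, hu, hvu⟩ := hvm
  obtain ⟨φ, hφ, rfl⟩ := hu.exists_eq_measurable_comp
  have hφf : Measurable fun x => φ (f x) := hφ.measurable.comp hf
  have hvL : MemLp (fun x => φ (f x)) 2 (P.map X) :=
    (memLp_map_measure_iff hφf.aestronglyMeasurable hX.aemeasurable).2 (hv.ae_eq hvu)
  obtain ⟨g, hg, hlt⟩ := hdense _ (hφ.measurable.comp (comap_measurable f)) hvL ε hε
  refine ⟨g, hg, ?_⟩
  change eLpNorm ((fun x => g x) - fun x => φ (f x)) 2 (P.map X) < ε at hlt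
  rw [eLpNorm_map_measure ((aestronglyMeasurable_apply hfeature g).sub hvL.1)
    hX.aemeasurable] at hlt
  refine lt_of_eq_of_lt (eLpNorm_congr_ae ?_) hlt
  filter_upwards [hvu] with ω hω
  simp [hω]


variable [IsProbabilityMeasure P]

/-- |u(X) - g(X)| ≤ ‖u - g‖ ‖κ(·,X)‖, so convergence in `H` implies convergence in L², which
preserves measurability. -/
theorem isClosed_functionsOf (hX : Measurable X) (hf : Measurable f)
    (hφ : MemLp (fun ω => feature H (X ω)) 2 P) : IsClosed (functionsOf H P X f : Set H) := by
  refine isSeqClosed_iff_isClosed.1 fun u g hu hg => ?_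
  rw [SetLike.mem_coe, mem_functionsOf_iff]
  have hlim : Tendsto (fun n => ‖u n - g‖ₑ * eLpNorm (fun ω => feature H (X ω)) 2 P) atTop
      (nhds 0) := by
    have h1 := tendsto_iff_enorm_sub_tendsto_zero.1 hg
    simpa only [zero_mul] using ENNReal.Tendsto.mul_const h1 (Or.inr hφ.2.ne)
  refine aestronglyMeasurable_of_forall_eLpNorm_sub_lt (hf.comp hX).comap_le
    (memLp_apply hφ g) fun ε hε => ?_
  obtain ⟨n, hn⟩ := (hlim.eventually_lt_const hε).exists
  refine ⟨fun ω => u n (X ω), memLp_apply hφ _, mem_functionsOf_iff.1 (hu n),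
    (eLpNorm_le_mul_eLpNorm_of_ae_le_mul'' 2 hφ.1 (ae_of_all _ fun ω => ?_)).trans_lt hn⟩
  have h1 : u n (X ω) - g (X ω) = inner ℝ (u n - g) (feature H (X ω)) := by
    rw [real_inner_comm, inner_sub_right, inner_feature, inner_feature]
  rw [Pi.sub_apply, h1]
  simp only [← ofReal_norm]
  rw [← ENNReal.ofReal_mul (norm_nonneg _)]
  exact ENNReal.ofReal_le_ofReal (norm_inner_le_norm _ _)

/-- A function of f(X) in `H` is an L² limit of central elements; each is a function of f'(X) for
any other sufficient f', and so is the limit. -/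
theorem centralClass_eq_functionsOf (hdense : CentralClassDense H P X Y f)
    (hX : Measurable X) (hf : IsSufficientPredictor P X Y f)
    (hfeature : AEStronglyMeasurable (feature H) (P.map X))
    (hφ : MemLp (fun ω => feature H (X ω)) 2 P) :
    centralClass H P X Y = functionsOf H P X f := by
  refine le_antisymm (iInf_le_of_le d (iInf₂_le f hf)) fun u hu => ?_
  simp only [centralClass, Submodule.mem_iInf]
  intro d' f' hf'
  rw [mem_functionsOf_iff] at hu ⊢
  refine aestronglyMeasurable_of_forall_eLpNorm_sub_lt (hf'.1.comp hX).comap_le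
    (memLp_apply hφ u) fun ε hε => ?_
  obtain ⟨g, hg, hlt⟩ := hdense.exists_eLpNorm_sub_lt hX hf.1 hfeature hu (memLp_apply hφ u) hε
  refine ⟨fun ω => g (X ω), memLp_apply hφ g, mem_functionsOf_iff.1 ?_, hlt⟩
  exact (iInf_le_of_le d' (iInf₂_le f' hf') : centralClass H P X Y ≤ functionsOf H P X f') hg

/-- If `𝒢_{Y|X}` is dense in `L₂(P_X | σ(f))` for a sufficient predictor `f`, an element of `H` whose
covariances with `H` are those of a square integrable function of `Y` is a function of `f(X)`. -/
theorem mem_functionsOf_of_covariance_eq (hdense : CentralClassDense H P X Y f)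
    (hX : Measurable X) (hY : Measurable Y) (hf : IsSufficientPredictor P X Y f)
    (hfeature : AEStronglyMeasurable (feature H) (P.map X))
    (hφ : MemLp (fun ω => feature H (X ω)) 2 P) {a : 𝒴 → ℝ}
    (ham : AEStronglyMeasurable a (P.map Y)) (ha : MemLp (fun ω => a (Y ω)) 2 P) {u : H}
    (hu : ∀ k : H, ∫ ω, k (X ω) * u (X ω) ∂P - (∫ ω, k (X ω) ∂P) * ∫ ω, u (X ω) ∂P
      = ∫ ω, (k (X ω) - ∫ ω, k (X ω) ∂P) * a (Y ω) ∂P) :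
    u ∈ functionsOf H P X f := by
  have hmX : MeasurableSpace.comap (fun ω => f (X ω)) inferInstance
      ≤ MeasurableSpace.comap X inferInstance := by
    rw [← Function.comp_def f X, ← MeasurableSpace.comap_comp]
    exact MeasurableSpace.comap_mono hf.1.comap_le
  have hm := hmX.trans hX.comap_le
  have hwL := ha.condExp (m := MeasurableSpace.comap (fun ω => f (X ω)) inferInstance) one_le_two
  obtain ⟨c, hc⟩ := exists_ae_eq_add_const_of_covariance_eq (fun k : H => memLp_apply hφ k) hwL
    (fun ε hε => by
      obtain ⟨g, -, hg⟩ := hdense.exists_eLpNorm_sub_lt hX hf.1 hfeature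
        stronglyMeasurable_condExp.aestronglyMeasurable hwL hε
      exact ⟨g, hg⟩) u (fun k => by
    have hkL := memLp_apply hφ k
    have hka : Integrable (fun ω => k (X ω) * a (Y ω)) P := hkL.integrable_mul ha
    rw [hu k, ← hf.2.integral_mul_eq hX hY hmX ham ha (aestronglyMeasurable_apply hfeature k) hkL,
      integral_condExp hm]
    simp only [sub_mul]
    rw [integral_sub hka ((ha.integrable one_le_two).const_mul _), integral_const_mul])
  rw [mem_functionsOf_iff]
  exact ⟨_, stronglyMeasurable_condExp.add stronglyMeasurable_const, hc⟩

end CentralClass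

section

variable {H : Type*} [NormedAddCommGroup H] [InnerProductSpace ℝ H] [CompleteSpace H]

/-- The outer projection in S = QSQ puts Sg in the closed range, where the inverse recovers it. -/
theorem opInv_comp_apply {T S : H →L[ℝ] H} (hT : IsSelfAdjoint T)
    (hS : S = T.range.topologicalClosure.starProjection ∘L S ∘L
      T.range.topologicalClosure.starProjection) (g : H) : opInv T (T (S g)) = S g := by
  refine opInv_apply T hT _ ?_
  rw [hS]
  exact Submodule.starProjection_apply_mem _ _

end

end WIRE

theorem proposition3
    {Ω : Type*} [MeasurableSpace Ω] (P : Measure Ω) [IsProbabilityMeasure P]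
    {𝒴 : Type*} [MetricSpace 𝒴] [MeasurableSpace 𝒴] [BorelSpace 𝒴]
    {p d : ℕ} (H : Type*) [NormedAddCommGroup H] [InnerProductSpace ℝ H] [CompleteSpace H]
    [RKHS ℝ H (EuclideanSpace ℝ (Fin p)) ℝ]
    (X : Ω → EuclideanSpace ℝ (Fin p)) (Y : Ω → 𝒴)
    (hX : Measurable X) (hY : Measurable Y)
    (hfeature : AEStronglyMeasurable (WIRE.feature H) (P.map X))
    (hdist : MemLp (fun z : Ω × Ω => dist (Y z.1) (Y z.2)) 2 (P.prod P))
    (hkappa : Integrable (fun ω => WIRE.kappa H (X ω) (X ω)) P)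
    (hrep : WIRE.HasCovRepresentation H P X Y)
    (f : EuclideanSpace ℝ (Fin p) → EuclideanSpace ℝ (Fin d))
    (hf : WIRE.IsSufficientPredictor P X Y f)
    (hdense : WIRE.CentralClassDense H P X Y f) :
    closure (Set.range fun g : H => WIRE.opInv (WIRE.covOp H P X) (WIRE.wireOp H P X Y g))
      ⊆ (WIRE.centralClass H P X Y : Set H) := by
  have hφ := WIRE.memLp_feature hX hfeature hkappa
  rw [WIRE.centralClass_eq_functionsOf hdense hX hf hfeature hφ]
  refine closure_minimal ?_ (WIRE.isClosed_functionsOf hX hf.1 hφ)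
  rintro _ ⟨g, rfl⟩
  obtain ⟨S, ⟨hΛ, hS⟩, -⟩ := hrep
  have hΛg : WIRE.wireOp H P X Y g = WIRE.covOp H P X (S g) := by rw [hΛ]; rfl
  simp only [hΛg]
  rw [WIRE.opInv_comp_apply (WIRE.isSelfAdjoint_covOp hφ) hS]
  have hgL : MemLp (fun ω => g (X ω) - ∫ ω, g (X ω) ∂P) 2 P :=
    (WIRE.memLp_apply hφ g).sub (memLp_const _)
  have hint : Integrable (fun z : Ω × Ω => (g (X z.2) - ∫ ω, g (X ω) ∂P) *
      dist (Y z.1) (Y z.2)) (P.prod P) := (hgL.comp_snd P).integrable_mul hdist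
  -- One integrable slice suffices: `Y ω₀` is the base point for continuity.
  obtain ⟨ω₀, hω₀⟩ := hint.prod_right_ae.exists
  dsimp only at hω₀
  have hcont := WIRE.continuous_integral_mul_dist hY (hgL.integrable one_le_two) (y₀ := Y ω₀) hω₀
  refine WIRE.mem_functionsOf_of_covariance_eq hdense hX hY hf hfeature hφ
    (a := fun y => -∫ ω', (g (X ω') - ∫ ω, g (X ω) ∂P) * dist y (Y ω') ∂P)
    hcont.neg.measurable.aestronglyMeasurable
    (WIRE.memLp_two_integral_mul hdist hgL).neg fun k => ?_
  rw [← WIRE.inner_covOp hφ, ← hΛg, WIRE.inner_wireOp hφ hdist]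
  simp only [mul_neg, integral_neg]
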